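/- Let $k$ be a field, let $G$ be a chordal graph on the vertex set $[n]=\{1,\dots,n\}$ (a finite simple graph in which each cycle of length greater than $3$ has a chord), let $\Delta$ be its clique complex, and let $d=\dim\Delta+1$ be the largest size of a clique of $G$. Let $R=k[x_1,\dots,x_n]$, let $k[\Delta]=R/I(\Delta)$ be the Stanley--Reisner ring, where $I(\Delta)$ is generated by the monomials $\prod_{i\in F}x_i$ with $F\subseteq[n]$, $F\notin\Delta$, and let $p$ be the projective dimension of the $R$-module $k[\Delta]$. Let $h_0,h_1,\dots$ be the $h$-vector of $\Delta$, defined by $$\sum_{i\ge 0}\dim_k k[\Delta]_i\,z^i=\frac{\sum_{i} h_i z^i}{(1-z)^d}$$ (so $h_i=0$ for $i>d$). Then $$\sum_{\ell=0}^{j}(-1)^\ell\, h_{j-\ell}\binom{n-d}{\ell}=0$$ for $j=1$ and for every $j$ with $p+2<j\le n$. -/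

import Mathlib

open CategoryTheory

namespace SimpleGraph

/-- A graph is chordal if each cycle of length greater than three has a chord, i.e. an edge of the
graph that joins two vertices of the cycle and is not itself an edge of the cycle. -/
def IsChordal {V : Type*} (G : SimpleGraph V) : Prop :=
  ∀ (v : V) (c : G.Walk v v), c.IsCycle → 3 < c.length → ∃ e : Sym2 V, c.IsChord e

/-- The clique complex of a graph: its (nonempty) faces are the (nonempty) finite cliques. -/
def cliqueComplex {V : Type*} (G : SimpleGraph V) : AbstractSimplicialComplex V where
  faces := {F | F.Nonempty ∧ G.IsClique (F : Set V)}
  isRelLowerSet_faces := fun _ hF =>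
    ⟨hF.1, fun _ hE hne => ⟨hne, hF.2.subset (Finset.coe_subset.mpr hE)⟩⟩
  singleton_mem := fun v => ⟨Finset.singleton_nonempty v, by simp⟩

end SimpleGraph

namespace AbstractSimplicialComplex

/-- The number `d = dim Δ + 1`, the largest cardinality of a face. It is `0` exactly when the
vertex set is empty, where the only face is the empty face, of dimension `-1` (the faces of an
`AbstractSimplicialComplex` are its nonempty faces; the empty face is implicit). -/
noncomputable def dimSucc {V : Type*} (Δ : AbstractSimplicialComplex V) : ℕ :=
  sSup (Finset.card '' Δ.faces)

/-- The Stanley-Reisner ideal, generated by the squarefree monomials `x^F` of the non-faces `F`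
(the empty set is always a face). -/
noncomputable def stanleyReisnerIdeal (k : Type*) [Field k] {n : ℕ}
    (Δ : AbstractSimplicialComplex (Fin n)) : Ideal (MvPolynomial (Fin n) k) :=
  Ideal.span {m | ∃ F : Finset (Fin n), F.Nonempty ∧ F ∉ Δ.faces ∧
    m = ∏ i ∈ F, MvPolynomial.X i}

/-- The Stanley-Reisner ring `k[Δ] = k[x₁, …, xₙ] / I(Δ)`. -/
abbrev StanleyReisnerRing (k : Type*) [Field k] {n : ℕ}
    (Δ : AbstractSimplicialComplex (Fin n)) : Type _ :=
  MvPolynomial (Fin n) k ⧸ Δ.stanleyReisnerIdeal k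

/-- The graded piece of degree `i` of `k[Δ]`: the image of the homogeneous polynomials of
degree `i`. -/
noncomputable def stanleyReisnerPiece (k : Type*) [Field k] {n : ℕ}
    (Δ : AbstractSimplicialComplex (Fin n)) (i : ℕ) : Submodule k (Δ.StanleyReisnerRing k) :=
  (MvPolynomial.homogeneousSubmodule (Fin n) k i).map
    (Ideal.Quotient.mkₐ k (Δ.stanleyReisnerIdeal k)).toLinearMap

/-- The Hilbert series `∑ᵢ dim_k k[Δ]ᵢ zⁱ` of the Stanley-Reisner ring. -/
noncomputable def hilbertSeries (k : Type*) [Field k] {n : ℕ}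
    (Δ : AbstractSimplicialComplex (Fin n)) : PowerSeries ℤ :=
  PowerSeries.mk fun i => (Module.finrank k (Δ.stanleyReisnerPiece k i) : ℤ)

/-- The `h`-vector: `hᵢ` is the `i`-th coefficient of the numerator in
`H_{k[Δ]}(z) = (∑ᵢ hᵢ zⁱ) / (1 - z)^d`, where `d = dim Δ + 1`. -/
noncomputable def hVector (k : Type*) [Field k] {n : ℕ}
    (Δ : AbstractSimplicialComplex (Fin n)) (i : ℕ) : ℤ :=
  PowerSeries.coeff i ((1 - PowerSeries.X) ^ Δ.dimSucc * Δ.hilbertSeries k)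

/-- The projective dimension of `k[Δ]` as a module over `k[x₁, …, xₙ]`. -/
noncomputable def stanleyReisnerProjDim (k : Type*) [Field k] {n : ℕ}
    (Δ : AbstractSimplicialComplex (Fin n)) : WithBot ℕ∞ :=
  projectiveDimension (ModuleCat.of (MvPolynomial (Fin n) k) (Δ.StanleyReisnerRing k))

end AbstractSimplicialComplex

-- Multiplying the Hilbert series by `(1 - z) ^ n` turns the alternating sum of the `h`-vector into
-- the `z ^ j` coefficient (`sum_hVector_mul_choose`). Expanding over faces,
-- `coeff_one_sub_X_pow_mul_hilbertSeries` writes that coefficient, up to sign, as the sum over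
-- vertex sets `W` of size `j` of the alternating clique counts of `G[W]`, which are reduced Euler
-- characteristics up to sign. It suffices that each of them vanishes.
--
-- If `G[W]` is connected, chordality makes its count zero (`IsChordal.sum_cliques_eq_zero`). If
-- `G[W]` is disconnected, the projective dimension is at least `|W| - 1`, which is excluded when `j
-- > p + 2`; for `j = 1` every `G[W]` is connected. Hochster's formula would give this bound; here
-- it comes from an explicit linear map out of the ideal of the variables of `W` which is not
-- multiplication by an element, whereas depth forces every such map to be one when the projective
-- dimension is small.

universe u

/-! ### Vanishing of `Ext` and extension of linear maps from ideals. -/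

open RingTheory.Sequence Abelian in
/-- If a sequence which is weakly regular on `M` annihilates `N`, then `Ext N M i = 0` for all `i`
smaller than its length. -/
theorem ModuleCat.subsingleton_ext_of_isWeaklyRegular {R : Type u} [CommRing R]
    (N : ModuleCat.{u} R) (rs : List R) (hN : ∀ r ∈ rs, r ∈ Module.annihilator R N)
    (M : ModuleCat.{u} R) (hM : IsWeaklyRegular M rs) (i : ℕ) (hi : i < rs.length) :
    Subsingleton (Ext N M i) := by
  induction rs generalizing M i with
  | nil => simp at hi
  | cons a rs ih =>
    rw [isWeaklyRegular_cons_iff] at hM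
    simp only [List.mem_cons, forall_eq_or_imp] at hN
    -- Multiplication by `a` on `Ext N M i` is zero because `a` kills `N`. It is also injective: in
    -- positive degree because the preceding `Ext` into `M / aM` vanishes by induction, in degree
    -- zero because `Hom N M = 0`. So the group is zero.
    have hmono : Mono (AddCommGrpCat.ofHom
        ((Ext.mk₀ (smulShortComplex M a).f).postcomp N (add_zero i))) := by
      cases i with
      | zero =>
        have : Subsingleton (N →ₗ[R] M) := by
          refine ⟨fun f g => LinearMap.ext fun x => hM.1 ?_⟩
          have hx : a • x = 0 := Module.mem_annihilator.mp hN.1 x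
          simp only [← map_smul, hx, map_zero]
        have : Subsingleton (Ext N M 0) :=
          (Ext.addEquiv₀.trans ModuleCat.homAddEquiv).subsingleton
        exact (AddCommGrpCat.mono_iff_injective _).mpr
          (Function.injective_of_subsingleton (α := Ext N M 0) _)
      | succ i =>
        apply (Ext.covariant_sequence_exact₁' N hM.1.smulShortComplex_shortExact i (i + 1)
          rfl).mono_g ((AddCommGrpCat.isZero_of_iff_subsingleton.mpr ?_).eq_zero_of_src _)
        exact ih hN.2 (ModuleCat.of R (QuotSMulTop a M)) hM.2 i (by simpa using hi)
    have hzero : AddCommGrpCat.ofHom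
        ((Ext.mk₀ (smulShortComplex M a).f).postcomp N (add_zero i)) = 0 :=
      Ext.postcomp_smul_id_eq_zero_of_mem_annihilator hN.1 i
    exact AddCommGrpCat.subsingleton_of_isZero (Limits.IsZero.of_mono_eq_zero _ hzero)

open RingTheory.Sequence Abelian in
/-- Vanishing of `Ext` into a module of small projective dimension: if a weakly `R`-regular
sequence annihilates `N` and `M` has projective dimension at most `m`, then `Ext N M i = 0`
whenever `i + m` is smaller than the length of the sequence. -/
theorem ModuleCat.subsingleton_ext_of_hasProjectiveDimensionLT {R : Type u} [CommRing R]
    (N : ModuleCat.{u} R) (rs : List R) (hN : ∀ r ∈ rs, r ∈ Module.annihilator R N)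
    (hR : IsWeaklyRegular R rs) (m : ℕ) (M : ModuleCat.{u} R)
    (hM : HasProjectiveDimensionLT M (m + 1)) (i : ℕ) (hi : i + m < rs.length) :
    Subsingleton (Ext N M i) := by
  induction m generalizing M i with
  | zero =>
    have hproj : Projective M := projective_iff_hasProjectiveDimensionLT_one.mpr hM
    have : Module.Projective R M := (IsProjective.iff_projective M).mpr hproj
    have hreg : IsWeaklyRegular M rs :=
      ((TensorProduct.rid R M).isWeaklyRegular_congr rs).mp hR.isWeaklyRegular_lTensor
    exact subsingleton_ext_of_isWeaklyRegular N rs hN M hreg i hi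
  | succ m ih =>
    -- Dimension shifting along a free cover: passing to the kernel raises `i` and lowers `m` by
    -- one, so `i + m` is preserved.
    have hsurj : Function.Surjective (Finsupp.linearCombination R (id : M → M)) :=
      Finsupp.linearCombination_id_surjective R M
    have hS := LinearMap.shortExact_shortComplexKer hsurj
    set S := (Finsupp.linearCombination R (id : M → M)).shortComplexKer with hSdef
    have hfree : Projective S.X₂ := (IsProjective.iff_projective (M →₀ R)).mp inferInstance
    have hker : HasProjectiveDimensionLT S.X₁ (m + 1) :=
      (hS.hasProjectiveDimensionLT_X₃_iff m hfree).mp hM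
    have h2 : Subsingleton (Ext N S.X₂ i) :=
      ih S.X₂ (hasProjectiveDimensionLT_of_ge _ 1 _ (by omega)) i (by omega)
    have h1 : Subsingleton (Ext N S.X₁ (i + 1)) := ih S.X₁ hker (i + 1) (by omega)
    refine ⟨fun x y => ?_⟩
    rw [← sub_eq_zero]
    obtain ⟨z, hz⟩ := Ext.covariant_sequence_exact₃ (S := S) N hS (x - y : Ext N S.X₃ i) rfl
      (Subsingleton.elim _ _)
    have hz0 : z = 0 := Subsingleton.elim _ _
    rw [hz0, Ext.zero_comp] at hz
    exact hz.symm

open RingTheory.Sequence Abelian in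
/-- If an ideal `J` contains a weakly regular sequence of length more than `m + 1`, then every
linear map from `J` to a module of projective dimension at most `m` is the multiplication by an
element. -/
theorem Ideal.exists_eq_smul_of_hasProjectiveDimensionLT {R : Type u} [CommRing R] (J : Ideal R)
    (rs : List R) (hJ : ∀ r ∈ rs, r ∈ J) (hR : IsWeaklyRegular R rs) (m : ℕ)
    (hm : m + 1 < rs.length) (M : Type u) [AddCommGroup M] [Module R M]
    (hM : HasProjectiveDimensionLT (ModuleCat.of R M) (m + 1)) (φ : J →ₗ[R] M) :
    ∃ y : M, ∀ f : J, φ f = (f : R) • y := by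
  have hN : ∀ r ∈ rs, r ∈ Module.annihilator R (R ⧸ J) := fun r hr => by
    rw [Ideal.annihilator_quotient]
    exact hJ r hr
  have hsurj : Function.Surjective J.mkQ := J.mkQ_surjective
  let S : ShortComplex (ModuleCat.{u} R) :=
    ShortComplex.mk (ModuleCat.ofHom J.subtype) (ModuleCat.ofHom J.mkQ) (by
      ext x
      exact (Submodule.Quotient.mk_eq_zero J).mpr x.2)
  have hS : S.ShortExact :=
    { exact := (ShortComplex.ShortExact.moduleCat_exact_iff_function_exact S).mpr
        (LinearMap.exact_subtype_mkQ J)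
      mono_f := (ModuleCat.mono_iff_injective _).mpr J.injective_subtype
      epi_g := (ModuleCat.epi_iff_surjective _).mpr hsurj }
  -- Vanishing of `Ext¹(R/J, M)` extends `φ` to all of `R`, where it is determined by the image of
  -- `1`.
  have hsub : Subsingleton (Ext S.X₃ (ModuleCat.of R M) 1) :=
    ModuleCat.subsingleton_ext_of_hasProjectiveDimensionLT (ModuleCat.of R (R ⧸ J)) rs hN hR m
      (ModuleCat.of R M) hM 1 (by omega)
  obtain ⟨x, hx⟩ := Ext.contravariant_sequence_exact₁ hS (ModuleCat.of R M)
    (Ext.mk₀ (ModuleCat.ofHom φ)) rfl (Subsingleton.elim _ _)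
  obtain ⟨g, rfl⟩ := (Ext.mk₀_bijective _ _).2 x
  rw [Ext.mk₀_comp_mk₀] at hx
  have hg := (Ext.mk₀_bijective _ _).1 hx
  refine ⟨g.hom (1 : R), fun f => ?_⟩
  have h : g.hom (f : R) = φ f := ConcreteCategory.congr_hom hg f
  rw [← h]
  exact (congrArg g.hom (mul_one (f : R)).symm).trans (g.hom.map_smul (f : R) (1 : R))

open RingTheory.Sequence in
/-- Distinct variables form a weakly regular sequence. -/
theorem MvPolynomial.isWeaklyRegular_map_X {σ k : Type*} [Field k] (l : List σ) (hl : l.Nodup) :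
    IsWeaklyRegular (MvPolynomial σ k) (l.map (X : σ → MvPolynomial σ k)) := by
  rw [isWeaklyRegular_iff]
  intro i hi
  rw [List.length_map] at hi
  rw [List.getElem_map, ← List.map_take]
  have hspan : (Ideal.ofList ((l.take i).map (X : σ → MvPolynomial σ k)) • ⊤ :
      Submodule (MvPolynomial σ k) (MvPolynomial σ k)) =
      Ideal.span (X '' {a | a ∈ l.take i}) := by
    rw [smul_eq_mul, Ideal.mul_top, Ideal.ofList]
    congr 1
    ext f
    simp only [Set.mem_ofPred_eq, List.mem_map, Set.mem_image]
  rw [hspan]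
  have hnot : l[i] ∉ l.take i := by
    intro h
    obtain ⟨a, ha, hai⟩ := List.mem_take_iff_getElem.mp h
    have := (hl.getElem_inj_iff).mp hai
    omega
  refine isSMulRegular_iff_right_eq_zero_of_smul.mpr fun x hx => ?_
  obtain ⟨f, rfl⟩ := Submodule.Quotient.mk_surjective _ x
  rw [← Submodule.Quotient.mk_smul, Submodule.Quotient.mk_eq_zero, smul_eq_mul, mul_comm,
    mem_ideal_span_X_image] at hx
  rw [Submodule.Quotient.mk_eq_zero, mem_ideal_span_X_image]
  intro m hm
  obtain ⟨a, ha, ham⟩ := hx (m + Finsupp.single l[i] 1) (by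
    rw [support_mul_X]
    simpa using hm)
  refine ⟨a, ha, ?_⟩
  have hne : l[i] ≠ a := fun h => hnot (h ▸ ha)
  simpa [Finsupp.single_apply, hne] using ham

/-! ### Connectivity and clique counts in chordal graphs. -/

namespace SimpleGraph

variable {V : Type*} {G : SimpleGraph V}

/-- A nonempty set of vertices which does not induce a connected subgraph splits into two nonempty
parts without edges between them. -/
theorem exists_partition_of_not_connected_induce {W : Set V} (hne : W.Nonempty)
    (hW : ¬ (G.induce W).Connected) : ∃ A B : Set V, A.Nonempty ∧ B.Nonempty ∧ Disjoint A B ∧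
      A ∪ B = W ∧ ∀ a ∈ A, ∀ b ∈ B, ¬ G.Adj a b := by
  have : Nonempty W := hne.to_subtype
  have hpre : ¬ (G.induce W).Preconnected := fun h => hW ⟨h⟩
  simp only [Preconnected, not_forall] at hpre
  obtain ⟨x, y, hxy⟩ := hpre
  refine ⟨Subtype.val '' {z : W | (G.induce W).Reachable x z},
    Subtype.val '' {z : W | ¬ (G.induce W).Reachable x z}, ⟨x, x, Reachable.refl x, rfl⟩,
    ⟨y, y, hxy, rfl⟩, ?_, ?_, ?_⟩
  · refine (Set.disjoint_image_iff Subtype.val_injective).mpr ?_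
    exact Set.disjoint_left.mpr fun z h h' => h' h
  · rw [← Set.image_union]
    ext z
    constructor
    · rintro ⟨z, -, rfl⟩
      exact z.2
    · exact fun hz => ⟨⟨z, hz⟩, em _, rfl⟩
  · rintro _ ⟨a, ha, rfl⟩ _ ⟨b, hb, rfl⟩ hab
    exact hb (Reachable.trans ha (Adj.reachable (G := G.induce W) hab))

/-- In a chordal graph, the neighbours of a vertex in a connected set of other vertices form a
connected set. -/
theorem IsChordal.connected_induce_neighborSet_inter (hG : G.IsChordal) {v : V} {C : Set V}
    (hC : (G.induce C).Connected) (hv : v ∉ C) (hne : (G.neighborSet v ∩ C).Nonempty) :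
    (G.induce (G.neighborSet v ∩ C)).Connected := by
  classical
  by_contra hcon
  obtain ⟨X, Y, ⟨x₀, hx₀⟩, ⟨y₀, hy₀⟩, hXY, hunion, hadj⟩ :=
    exists_partition_of_not_connected_induce hne hcon
  have hXN {x} (h : x ∈ X) : x ∈ G.neighborSet v ∩ C := hunion ▸ Or.inl h
  have hYN {y} (h : y ∈ Y) : y ∈ G.neighborSet v ∩ C := hunion ▸ Or.inr h
  -- a shortest walk within `C` from `X` to `Y`, closed up at `v`
  have hex : ∃ m, ∃ x ∈ X, ∃ y ∈ Y, ∃ p : G.Walk x y, (∀ u ∈ p.support, u ∈ C) ∧ p.length = m := by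
    obtain ⟨q⟩ := hC.preconnected ⟨x₀, (hXN hx₀).2⟩ ⟨y₀, (hYN hy₀).2⟩
    refine ⟨_, x₀, hx₀, y₀, hy₀, q.map (Embedding.induce C).toHom, ?_, rfl⟩
    intro u hu
    obtain ⟨w, -, rfl⟩ := List.mem_map.mp (Walk.support_map _ q ▸ hu)
    exact w.2
  obtain ⟨x, hx, y, hy, p', hp'C, hp'len⟩ := Nat.find_spec hex
  have hmin {x y : V} (hx : x ∈ X) (hy : y ∈ Y) (q : G.Walk x y) (hq : ∀ u ∈ q.support, u ∈ C) :
      p'.length ≤ q.length := hp'len ▸ Nat.find_min' hex ⟨x, hx, y, hy, q, hq, rfl⟩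
  obtain ⟨p, hp, hpC, hplen⟩ : ∃ p : G.Walk x y, p.IsPath ∧ (∀ u ∈ p.support, u ∈ C) ∧
      p.length ≤ p'.length :=
    ⟨p'.bypass, p'.bypass_isPath, fun u hu => hp'C u (p'.support_bypass_subset_support hu),
      p'.length_bypass_le_length⟩
  replace hmin {x y : V} (hx : x ∈ X) (hy : y ∈ Y) (q : G.Walk x y)
      (hq : ∀ u ∈ q.support, u ∈ C) : p.length ≤ q.length := hplen.trans (hmin hx hy q hq)
  -- A neighbour of `v` on `p` lies in `X` or `Y`. Since `p` is shortest among all walks in `C` from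
  -- `X` to `Y`, an interior one would cut off a shorter walk.
  have hnb {u : V} (hu : u ∈ p.support) (huv : G.Adj v u) : u = x ∨ u = y := by
    have hmem : u ∈ X ∪ Y := hunion ▸ ⟨huv, hpC u hu⟩
    have hsum := congrArg Walk.length (p.take_spec hu)
    rw [Walk.length_append] at hsum
    rcases hmem with hmem | hmem
    · have := hmin hmem hy (p.dropUntil u hu) fun w hw =>
        hpC w (p.support_dropUntil_subset_support hu hw)
      exact Or.inl (Walk.eq_of_length_eq_zero (p := p.takeUntil u hu) (by omega)).symm
    · have := hmin hx hmem (p.takeUntil u hu) fun w hw =>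
        hpC w (p.support_takeUntil_subset_support hu hw)
      exact Or.inr (Walk.eq_of_length_eq_zero (p := p.dropUntil u hu) (by omega))
  have hshort {i j : ℕ} (hij : i < j) (hj : j ≤ p.length)
      (h : G.Adj (p.getVert i) (p.getVert j)) : s(p.getVert i, p.getVert j) ∈ p.edges := by
    have hlen := hmin hx hy ((p.take i).append (Walk.cons h (p.drop j))) (by
      intro u hu
      rw [Walk.mem_support_append_iff, Walk.support_cons, List.mem_cons] at hu
      rcases hu with hu | rfl | hu
      · rw [Walk.support_take] at hu
        exact hpC u (List.mem_of_mem_take hu)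
      · exact hpC _ (p.getVert_mem_support i)
      · rw [Walk.drop_support_eq_support_drop_min] at hu
        exact hpC u (List.mem_of_mem_drop hu))
    rw [Walk.length_append, Walk.length_cons, Walk.take_length, Walk.drop_length] at hlen
    obtain rfl : j = i + 1 := by omega
    exact Walk.adj_toSubgraph_iff_mem_edges.mp (p.toSubgraph_adj_getVert (by omega))
  have hpchord : p.IsChordless := by
    rw [Walk.isChordless_iff_forall_mem_edges]
    intro u w hu hw huw
    obtain ⟨i, rfl, hi⟩ := Walk.mem_support_iff_exists_getVert.mp hu
    obtain ⟨j, rfl, hj⟩ := Walk.mem_support_iff_exists_getVert.mp hw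
    rcases lt_trichotomy i j with hij | rfl | hij
    · exact hshort hij hj huw
    · exact absurd huw (G.loopless.irrefl _)
    · rw [Sym2.eq_swap]
      exact hshort hij hi huw.symm
  have hxy : x ≠ y := fun h => Set.disjoint_left.mp hXY hx (h ▸ hy)
  have hvx : G.Adj v x := (hXN hx).1
  have hvy : G.Adj v y := (hYN hy).1
  have hvp : v ∉ p.support := fun h => hv (hpC v h)
  have hcyc : (Walk.cons hvy.symm (Walk.cons hvx p)).IsCycle := by
    rw [Walk.cons_isCycle_iff, Walk.cons_isPath_iff, Walk.edges_cons, List.mem_cons]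
    refine ⟨⟨hp, hvp⟩, ?_⟩
    rintro (h | h)
    · rw [Sym2.eq_iff] at h
      rcases h with ⟨h, -⟩ | ⟨h, -⟩
      · exact hvy.ne h.symm
      · exact hxy h.symm
    · exact hvp (p.snd_mem_support_of_mem_edges h)
  -- There is no edge between `X` and `Y`; hence the cycle through `v` has length at least four and
  -- chordality applies.
  have hlen : 2 ≤ p.length := by
    by_contra hlt
    have h01 : p.length = 0 ∨ p.length = 1 := by omega
    rcases h01 with h | h
    · exact hxy (Walk.eq_of_length_eq_zero h)
    · exact hadj x hx y hy (Walk.adj_of_length_eq_one h)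
  obtain ⟨e, he⟩ := hG _ _ hcyc (by simp only [Walk.length_cons]; omega)
  revert he
  induction e with | _ u w
  rw [Walk.isChord_sym2Mk]
  rintro ⟨huw, hnot, hu, hw⟩
  simp only [Walk.edges_cons, List.mem_cons, not_or] at hnot
  have hcase (u : V) (h : u ∈ (Walk.cons hvy.symm (Walk.cons hvx p)).support) :
      u = v ∨ u ∈ p.support := by
    simp only [Walk.support_cons, List.mem_cons] at h
    rcases h with rfl | rfl | h
    exacts [Or.inr p.end_mem_support, Or.inl rfl, Or.inr h]
  replace hu := hcase u hu
  replace hw := hcase w hw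
  rcases hu with rfl | hu <;> rcases hw with rfl | hw
  · exact G.loopless.irrefl _ huw
  · rcases hnb hw huw with rfl | rfl
    · exact hnot.2.1 rfl
    · exact hnot.1 Sym2.eq_swap
  · rcases hnb hu huw.symm with rfl | rfl
    · exact hnot.2.1 Sym2.eq_swap
    · exact hnot.1 rfl
  · exact hnot.2.2 (hpchord.mem_edges hu hw huw)

/-- A finite connected set with at least two vertices has a vertex whose removal leaves it
connected. -/
theorem exists_connected_induce_erase [DecidableEq V] {W : Finset V} (hW : W.Nontrivial)
    (hconn : (G.induce (W : Set V)).Connected) :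
    ∃ v ∈ W, (G.induce (W.erase v : Set V)).Connected := by
  have : Nontrivial (W : Set V) := (Finset.nontrivial_coe.mpr hW).coe_sort
  obtain ⟨v, hv⟩ := hconn.exists_connected_induce_compl_singleton_of_finite_nontrivial
  refine ⟨v, v.2, ?_⟩
  let e : (({v}ᶜ : Set (W : Set V))) ≃ ((W.erase v : Finset V) : Set V) :=
    { toFun := fun x => ⟨x.1.1, Finset.mem_coe.mpr (Finset.mem_erase.mpr
        ⟨fun h => x.2 (Subtype.ext h), x.1.2⟩)⟩
      invFun := fun x => ⟨⟨x.1, Finset.mem_of_mem_erase x.2⟩, fun h =>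
        Finset.ne_of_mem_erase x.2 (congrArg Subtype.val h)⟩
      left_inv := fun x => rfl
      right_inv := fun x => rfl }
  exact (Iso.connected_iff (⟨e, Iff.rfl⟩ : (G.induce (W : Set V)).induce {v}ᶜ ≃g
    G.induce ((W.erase v : Finset V) : Set V))).mp hv

open Finset in
/-- The reduced Euler characteristic of the clique complex of a connected chordal graph
vanishes. -/
theorem IsChordal.sum_cliques_eq_zero [DecidableEq V]
    [DecidablePred fun F : Finset V => G.IsClique (F : Set V)] (hG : G.IsChordal)
    (W : Finset V) (hW : (G.induce (W : Set V)).Connected) :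
    ∑ F ∈ W.powerset, (if G.IsClique (F : Set V) then (-1 : ℤ) ^ #F else 0) = 0 := by
  classical
  induction W using Finset.strongInduction with | H W ih
  have hWne : W.Nonempty := by
    obtain ⟨x⟩ := hW.nonempty
    exact ⟨x, x.2⟩
  rcases hWne.exists_eq_singleton_or_nontrivial with ⟨v, rfl⟩ | hnt
  · rw [← insert_empty_eq, sum_powerset_insert (notMem_empty v)]
    simp
  -- With `v` not a cut vertex, cliques through `v` are `v` joined to cliques of its neighbourhood
  -- `N`. The sum for `W` is thus the sum for `C` minus that for `N`, both smaller and connected.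
  obtain ⟨v, hv, hconn⟩ := exists_connected_induce_erase hnt hW
  set C := W.erase v with hCdef
  have hvC : v ∉ C := notMem_erase v W
  have hCW : C ⊂ W := erase_ssubset hv
  set N := C.filter (G.Adj v) with hNdef
  have hNcoe : (N : Set V) = G.neighborSet v ∩ C := by
    ext x
    simp [hNdef, and_comm]
  have hNne : (G.neighborSet v ∩ (C : Set V)).Nonempty := by
    have : Nontrivial (W : Set V) := (Finset.nontrivial_coe.mpr hnt).coe_sort
    obtain ⟨x, hx⟩ := hW.preconnected.exists_adj_of_nontrivial ⟨v, hv⟩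
    have hvx : G.Adj v x := hx
    exact ⟨x, hvx, mem_erase.mpr ⟨hvx.ne', x.2⟩⟩
  have hNconn : (G.induce (N : Set V)).Connected :=
    hNcoe ▸ hG.connected_induce_neighborSet_inter hconn hvC hNne
  have hins (F : Finset V) (hF : F ∈ C.powerset) :
      (if G.IsClique (insert v F : Finset V) then (-1 : ℤ) ^ #(insert v F) else 0) =
        -(if F ∈ N.powerset then if G.IsClique (F : Set V) then (-1 : ℤ) ^ #F else 0 else 0) := by
    have hFC := mem_powerset.mp hF
    have hvF : v ∉ F := fun h => hvC (hFC h)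
    have hiff : G.IsClique ((insert v F : Finset V) : Set V) ↔
        F ∈ N.powerset ∧ G.IsClique (F : Set V) := by
      rw [coe_insert, isClique_insert_of_notMem (by simpa using hvF), mem_powerset, and_comm]
      refine and_congr_left fun _ => ⟨fun h x hx => ?_, fun h x hx => ?_⟩
      · exact mem_filter.mpr ⟨hFC hx, h x hx⟩
      · exact (mem_filter.mp (h hx)).2
    rw [card_insert_of_notMem hvF, pow_succ, ← ite_and]
    simp only [hiff]
    split_ifs <;> simp
  have hNC : N.powerset ⊆ C.powerset := powerset_mono.mpr (filter_subset _ _)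
  rw [← insert_erase hv, sum_powerset_insert hvC, sum_congr rfl hins, sum_neg_distrib,
    sum_ite_mem, inter_eq_right.mpr hNC, ih C hCW hconn,
    ih N ((filter_subset _ _).trans_ssubset hCW) hNconn, neg_zero, add_zero]

end SimpleGraph

/-! ### Lower bound for the projective dimension. -/

namespace AbstractSimplicialComplex

open MvPolynomial

variable {k : Type*} [Field k] {n : ℕ} (Δ : AbstractSimplicialComplex (Fin n))

/-- The Stanley-Reisner ideal has no linear forms: it is killed by sending all variables to the
dual number `ε`. -/
theorem aeval_eps_eq_zero_of_mem_stanleyReisnerIdeal {f : MvPolynomial (Fin n) k}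
    (hf : f ∈ Δ.stanleyReisnerIdeal k) :
    aeval (fun _ : Fin n => (DualNumber.eps : DualNumber k)) f = 0 := by
  suffices h : Δ.stanleyReisnerIdeal k ≤
      RingHom.ker (aeval (fun _ : Fin n => (DualNumber.eps : DualNumber k))) from h hf
  refine Ideal.span_le.mpr ?_
  rintro _ ⟨F, hF, hFΔ, rfl⟩
  -- All vertices are faces, so each generator has degree at least two and dies since `ε ^ 2 = 0`.
  have hcard : 2 ≤ F.card := by
    by_contra h
    have h1 : F.card = 1 := by have := hF.card_pos; omega
    obtain ⟨v, rfl⟩ := Finset.card_eq_one.mp h1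
    exact hFΔ (Δ.singleton_mem v)
  simp only [SetLike.mem_coe, RingHom.mem_ker, map_prod, aeval_X, Finset.prod_const]
  exact pow_eq_zero_of_le hcard DualNumber.eps_pow_two

theorem nontrivial_stanleyReisnerRing : Nontrivial (Δ.StanleyReisnerRing k) := by
  refine Ideal.Quotient.nontrivial_iff.mpr fun h => ?_
  have h1 := Δ.aeval_eps_eq_zero_of_mem_stanleyReisnerIdeal (k := k)
    (h ▸ Submodule.mem_top (x := (1 : MvPolynomial (Fin n) k)))
  rw [map_one] at h1
  exact one_ne_zero (congrArg TrivSqZeroExt.fst h1)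

/-- If two nonempty disjoint sets of vertices are not joined by edges, then the projective
dimension of the Stanley-Reisner ring is at least the number of vertices in their union
minus one. -/
theorem not_hasProjectiveDimensionLT_of_not_joined (A B : Finset (Fin n)) (hA : A.Nonempty)
    (hB : B.Nonempty) (hAB : Disjoint A B) (hedge : ∀ a ∈ A, ∀ b ∈ B, {a, b} ∉ Δ.faces) (m : ℕ)
    (hm : m + 1 < A.card + B.card) :
    ¬ HasProjectiveDimensionLT
      (ModuleCat.of (MvPolynomial (Fin n) k) (Δ.StanleyReisnerRing k)) (m + 1) := by
  intro hpd
  let R := MvPolynomial (Fin n) k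
  let I : Ideal R := Δ.stanleyReisnerIdeal k
  let JA : Ideal R := Ideal.span (X '' (A : Set (Fin n)))
  let JB : Ideal R := Ideal.span (X '' (B : Set (Fin n)))
  let J : Ideal R := JA ⊔ JB
  let ρ : R →ₐ[k] R := aeval fun i => if i ∈ B then 0 else X i
  have hρX (i) : ρ (X i) = if i ∈ B then 0 else X i := aeval_X _ _
  have hmul : JA * JB ≤ I := by
    rw [Ideal.span_mul_span', Ideal.span_le]
    rintro _ ⟨_, ⟨a, ha, rfl⟩, _, ⟨b, hb, rfl⟩, rfl⟩
    have hab : a ≠ b := fun h => Finset.disjoint_left.mp hAB ha (h ▸ hb)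
    exact Ideal.subset_span ⟨{a, b}, Finset.insert_nonempty _ _, hedge a ha b hb, by
      simp [Finset.prod_pair hab]⟩
  have hρB (f : R) : f - ρ f ∈ JB := by
    have h : (Ideal.Quotient.mkₐ k JB).comp ρ = Ideal.Quotient.mkₐ k JB := by
      refine algHom_ext fun i => ?_
      simp only [AlgHom.comp_apply, hρX]
      split_ifs with hi
      · rw [map_zero, eq_comm]
        exact Ideal.Quotient.eq_zero_iff_mem.mpr (Ideal.subset_span ⟨i, hi, rfl⟩)
      · rfl
    exact Ideal.Quotient.eq.mp (DFunLike.congr_fun h f).symm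
  have hρA {f : R} (hf : f ∈ J) : ρ f ∈ JA := by
    suffices h : J ≤ JA.comap ρ from h hf
    refine sup_le (Ideal.span_le.mpr ?_) (Ideal.span_le.mpr ?_)
    · rintro _ ⟨a, ha, rfl⟩
      change ρ (X a) ∈ JA
      rw [hρX, if_neg (Finset.disjoint_left.mp hAB ha)]
      exact Ideal.subset_span ⟨a, ha, rfl⟩
    · rintro _ ⟨b, hb, rfl⟩
      change ρ (X b) ∈ JA
      rw [hρX, if_pos (Finset.mem_coe.mp hb)]
      exact JA.zero_mem
  -- Modulo `I` this projects `JA + JB` onto `JA`. It is `R`-linear because `JA * JB ≤ I`.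
  let φ : J →ₗ[R] R ⧸ I :=
    { toFun := fun f => Ideal.Quotient.mk I (ρ f)
      map_add' := fun f g => by simp
      map_smul' := fun r f => by
        change Ideal.Quotient.mk I (ρ (r * f)) = Ideal.Quotient.mk I (r * ρ f)
        rw [eq_comm, Ideal.Quotient.eq, map_mul, ← sub_mul, mul_comm]
        exact hmul (Ideal.mul_mem_mul (hρA f.2) (hρB r)) }
  have hJA {a} (ha : a ∈ A) : X a ∈ J := Ideal.mem_sup_left (Ideal.subset_span ⟨a, ha, rfl⟩)
  have hJB {b} (hb : b ∈ B) : X b ∈ J := Ideal.mem_sup_right (Ideal.subset_span ⟨b, hb, rfl⟩)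
  obtain ⟨y, hy⟩ := J.exists_eq_smul_of_hasProjectiveDimensionLT ((A ∪ B).toList.map X) (by
      intro r hr
      obtain ⟨i, hi, rfl⟩ := List.mem_map.mp hr
      rcases Finset.mem_union.mp (Finset.mem_toList.mp hi) with hi | hi
      exacts [hJA hi, hJB hi])
    (isWeaklyRegular_map_X _ (Finset.nodup_toList _)) m (by
      rwa [List.length_map, Finset.length_toList, Finset.card_union_of_disjoint hAB])
    (R ⧸ I) hpd φ
  obtain ⟨g, rfl⟩ := Ideal.Quotient.mk_surjective y
  obtain ⟨a, ha⟩ := hA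
  obtain ⟨b, hb⟩ := hB
  have h1 : X a - X a * g ∈ I := by
    have := hy ⟨X a, hJA ha⟩
    change Ideal.Quotient.mk I (ρ (X a)) = Ideal.Quotient.mk I (X a * g) at this
    rwa [hρX, if_neg (Finset.disjoint_left.mp hAB ha), Ideal.Quotient.eq] at this
  have h2 : X b * g ∈ I := by
    have := hy ⟨X b, hJB hb⟩
    change Ideal.Quotient.mk I (ρ (X b)) = Ideal.Quotient.mk I (X b * g) at this
    rwa [hρX, if_pos hb, map_zero, eq_comm, Ideal.Quotient.eq_zero_iff_mem] at this
  -- `φ` fixes `X a` and kills `X b`, so the constant term of `g` would be both `1` and `0`. Both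
  -- variables map to `ε`, which turns this into `ε = 0`.
  have e1 := Δ.aeval_eps_eq_zero_of_mem_stanleyReisnerIdeal h1
  have e2 := Δ.aeval_eps_eq_zero_of_mem_stanleyReisnerIdeal h2
  simp only [map_sub, map_mul, aeval_X] at e1 e2
  rw [e2, sub_zero] at e1
  have := congrArg TrivSqZeroExt.snd e1
  simp at this

end AbstractSimplicialComplex

/-! ### Generating functions. -/

namespace PowerSeries

/-- The coefficients of a power of `1 - X`. -/
theorem coeff_one_sub_X_pow {R : Type*} [CommRing R] (N l : ℕ) :
    coeff l ((1 - X : PowerSeries R) ^ N) = (-1) ^ l * (N.choose l : R) := by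
  have h : ((1 - X : PowerSeries R) ^ N) = rescale (-1 : R)
      (((1 + Polynomial.X : Polynomial R) ^ N : Polynomial R) : PowerSeries R) := by
    simp [sub_eq_add_neg]
  rw [h, coeff_rescale, Polynomial.coeff_coe, Polynomial.coeff_one_add_X_pow]

/-- The monomials supported exactly on a set of `c` variables have the generating function
`(X + X ^ 2 + ⋯) ^ c`. -/
theorem coeff_pow_mk_pos {ι : Type*} [Fintype ι] [DecidableEq ι] (F : Finset ι) (i : ℕ) :
    coeff i ((mk fun m => if m = 0 then 0 else 1 : PowerSeries ℤ) ^ F.card) =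
      (((Finset.univ : Finset ι).finsuppAntidiag i).filter fun m => m.support = F).card := by
  rw [← Finset.prod_const, coeff_prod, Finset.card_filter, Nat.cast_sum]
  simp only [coeff_mk]
  have hsub : F.finsuppAntidiag i ⊆ (Finset.univ : Finset ι).finsuppAntidiag i :=
    Finset.finsuppAntidiag_mono (Finset.subset_univ F) i
  rw [← Finset.sum_subset hsub]
  · refine Finset.sum_congr rfl fun m hm => ?_
    have hmF := (Finset.mem_finsuppAntidiag.mp hm).2
    by_cases h : m.support = F
    · rw [if_pos h, Nat.cast_one]
      refine Finset.prod_eq_one fun a ha => if_neg ?_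
      rwa [← h, Finsupp.mem_support_iff] at ha
    · rw [if_neg h, Nat.cast_zero]
      obtain ⟨a, ha, ham⟩ := Finset.exists_of_ssubset (hmF.ssubset_of_ne h)
      exact Finset.prod_eq_zero ha (if_pos (Finsupp.notMem_support_iff.mp ham))
  · intro m hm hmF
    rw [if_neg, Nat.cast_zero]
    intro h
    refine hmF (Finset.mem_finsuppAntidiag.mpr ⟨?_, h.subset⟩)
    rw [← (Finset.mem_finsuppAntidiag.mp hm).1]
    refine Finset.sum_subset (Finset.subset_univ F) fun a _ ha => ?_
    rwa [← h, Finsupp.notMem_support_iff] at ha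

/-- Expansion of `X ^ |F| (1 - X) ^ (n - |F|)` over the supersets of `F`. -/
theorem coeff_X_pow_mul_one_sub_X_pow {ι : Type*} [Fintype ι] [DecidableEq ι] (F : Finset ι)
    (j : ℕ) :
    coeff j ((X : PowerSeries ℤ) ^ F.card * (1 - X) ^ (Fintype.card ι - F.card)) =
      ∑ W ∈ Finset.powersetCard j Finset.univ,
        if F ⊆ W then (-1) ^ j * (-1) ^ F.card else 0 := by
  -- Expand the product of `1 - X` over the complement of `F` and put `W = F ∪ T`. The sign of
  -- exponent `|T|` is split as a product to avoid subtraction.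
  have h : (X : PowerSeries ℤ) ^ F.card * (1 - X) ^ (Fintype.card ι - F.card) =
      ∑ W : Finset ι, if F ⊆ W then C ((-1) ^ W.card * (-1) ^ F.card) * X ^ W.card else 0 := by
    rw [← Finset.sum_filter]
    have hIcc : (Finset.univ.filter fun W => F ⊆ W) = Finset.Icc F Finset.univ := by
      ext W
      simp
    rw [hIcc, Finset.Icc_eq_image_powerset (Finset.subset_univ F), Finset.sum_image, sub_eq_add_neg,
      ← Finset.card_univ, ← Finset.card_sdiff_of_subset (Finset.subset_univ F),
      ← Finset.prod_const (s := Finset.univ \ F), Finset.prod_one_add, Finset.mul_sum]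
    · refine Finset.sum_congr rfl fun T hT => ?_
      have hd : Disjoint F T :=
        (Finset.disjoint_sdiff (s := F) (t := Finset.univ)).mono_right (Finset.mem_powerset.mp hT)
      rw [Finset.card_union_of_disjoint hd, Finset.prod_const, neg_pow, pow_add, pow_add,
        mul_right_comm, ← pow_add, ← two_mul, pow_mul]
      simp
      ring
    · have key {T : Finset ι} (hT : T ⊆ Finset.univ \ F) : (F ∪ T) \ F = T :=
        Finset.union_sdiff_cancel_left (Finset.disjoint_sdiff.mono_right hT)
      intro T hT T' hT' hTT
      rw [← key (Finset.mem_powerset.mp hT), ← key (Finset.mem_powerset.mp hT')]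
      exact congrArg (· \ F) hTT
  have hcard : Finset.powersetCard j (Finset.univ : Finset ι) =
      Finset.univ.filter fun W => W.card = j := by
    ext W
    simp
  rw [h, map_sum, hcard, Finset.sum_filter]
  refine Finset.sum_congr rfl fun W _ => ?_
  by_cases hFW : F ⊆ W
  · simp only [if_pos hFW, coeff_C_mul, coeff_X_pow, eq_comm (a := j)]
    split_ifs with hj
    · rw [hj, mul_one]
    · rw [mul_zero]
  · simp only [if_neg hFW, map_zero, ite_self]

end PowerSeries

/-! ### Hilbert series and `h`-vector. -/

namespace AbstractSimplicialComplex

open MvPolynomial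

variable {k : Type*} [Field k] {n : ℕ} (Δ : AbstractSimplicialComplex (Fin n))

/-- The faces of a complex, including the empty one. -/
def IsFace {V : Type*} (Δ : AbstractSimplicialComplex V) (F : Finset V) : Prop :=
  F.Nonempty → F ∈ Δ.faces

theorem IsFace.mono {V : Type*} {Δ : AbstractSimplicialComplex V} {F E : Finset V}
    (hF : Δ.IsFace F) (h : E ⊆ F) : Δ.IsFace E := fun hE =>
  (Δ.isRelLowerSet_faces (hF (hE.mono h))).2 h hE

/-- A polynomial lies in the Stanley-Reisner ideal if and only if the support of none of its
monomials is a face. -/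
theorem mem_stanleyReisnerIdeal_iff {f : MvPolynomial (Fin n) k} :
    f ∈ Δ.stanleyReisnerIdeal k ↔ ∀ m ∈ f.support, ¬ Δ.IsFace m.support := by
  have hspan : Δ.stanleyReisnerIdeal k = Ideal.span ((fun m => monomial m (1 : k)) ''
      {m | ∃ F : Finset (Fin n), ¬ Δ.IsFace F ∧ m = ∑ i ∈ F, Finsupp.single i 1}) := by
    rw [stanleyReisnerIdeal]
    congr 1
    ext f
    constructor
    · rintro ⟨F, hF, hFΔ, rfl⟩
      exact ⟨_, ⟨F, fun h => hFΔ (h hF), rfl⟩, by simp only [monomial_sum_one]; rfl⟩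
    · rintro ⟨_, ⟨F, hF, rfl⟩, rfl⟩
      obtain ⟨hne, hFΔ⟩ := Classical.not_imp.mp hF
      exact ⟨F, hne, hFΔ, by simp only [monomial_sum_one]; rfl⟩
  rw [hspan, mem_ideal_span_monomial_image]
  refine forall₂_congr fun m _ => ?_
  have hle (F : Finset (Fin n)) : ∑ i ∈ F, Finsupp.single i 1 ≤ m ↔ F ⊆ m.support := by
    rw [Finsupp.le_def]
    simp only [Finsupp.finsetSum_apply, Finsupp.single_apply, Finset.sum_ite_eq']
    refine forall_congr' fun i => ?_
    rw [Finsupp.mem_support_iff]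
    split_ifs with h <;> simp [h, Nat.one_le_iff_ne_zero]
  constructor
  · rintro ⟨_, ⟨F, hF, rfl⟩, hm⟩ hface
    exact hF (hface.mono ((hle F).mp hm))
  · exact fun h => ⟨_, ⟨m.support, h, rfl⟩, (hle _).mpr subset_rfl⟩

open Classical in
/-- The monomials whose support is a face form a basis of the Stanley-Reisner ring. -/
theorem finrank_stanleyReisnerPiece (i : ℕ) :
    Module.finrank k (Δ.stanleyReisnerPiece k i) =
      (((Finset.univ : Finset (Fin n)).finsuppAntidiag i).filter
        fun m => Δ.IsFace m.support).card := by
  set S := ((Finset.univ : Finset (Fin n)).finsuppAntidiag i).filter fun m => Δ.IsFace m.support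
  have hS (m : Fin n →₀ ℕ) : m ∈ S ↔ m.degree = i ∧ Δ.IsFace m.support := by
    simp [S, Finset.mem_finsuppAntidiag, Finsupp.degree_eq_sum]
  let π := (Ideal.Quotient.mkₐ k (Δ.stanleyReisnerIdeal k)).toLinearMap
  have hπ (f : MvPolynomial (Fin n) k) : π f = 0 ↔ f ∈ Δ.stanleyReisnerIdeal k :=
    Ideal.Quotient.eq_zero_iff_mem
  have hmap : Δ.stanleyReisnerPiece k i = (restrictSupport k (S : Set (Fin n →₀ ℕ))).map π := by
    rw [stanleyReisnerPiece, homogeneousSubmodule_eq_finsupp_supported]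
    refine le_antisymm ?_ (Submodule.map_mono (restrictSupport_mono k fun m hm => ((hS m).mp hm).1))
    change (restrictSupport k {d : Fin n →₀ ℕ | d.degree = i}).map π ≤ _
    rw [restrictSupport_eq_span, Submodule.map_span, Submodule.span_le]
    rintro _ ⟨_, ⟨m, hm, rfl⟩, rfl⟩
    by_cases hface : Δ.IsFace m.support
    · exact ⟨_, (monomial_mem_restrictSupport k).mpr (Or.inl ((hS m).mpr ⟨hm, hface⟩)), rfl⟩
    · have : π (monomial m 1) = 0 := (hπ _).mpr <| Δ.mem_stanleyReisnerIdeal_iff.mpr fun m' hm' => by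
        rwa [Finset.mem_singleton.mp (support_monomial_subset hm')]
      exact this ▸ Submodule.zero_mem _
  -- An element of the ideal contains no face monomial, so face monomials stay independent in the
  -- quotient.
  have hinj : Function.Injective (π.domRestrict (restrictSupport k (S : Set (Fin n →₀ ℕ)))) := by
    rw [injective_iff_map_eq_zero]
    intro f hf
    have hI := Δ.mem_stanleyReisnerIdeal_iff.mp ((hπ f).mp hf)
    refine Subtype.ext (support_eq_empty.mp (Finset.eq_empty_of_forall_notMem fun m hm => ?_))
    exact hI m hm ((hS m).mp ((mem_restrictSupport_iff k).mp f.2 hm)).2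
  rw [hmap, ← LinearMap.range_domRestrict, LinearMap.finrank_range_of_inj hinj,
    Module.finrank_eq_card_basis (basisRestrictSupport k (S : Set (Fin n →₀ ℕ)))]
  simp

open Classical in
/-- The Hilbert series as a sum over the faces. -/
theorem hilbertSeries_eq_sum :
    Δ.hilbertSeries k = ∑ F with Δ.IsFace F,
      (PowerSeries.mk fun m => if m = 0 then 0 else 1) ^ F.card := by
  ext i
  rw [hilbertSeries, PowerSeries.coeff_mk, finrank_stanleyReisnerPiece, map_sum]
  simp only [PowerSeries.coeff_pow_mk_pos]
  rw [← Nat.cast_sum, Finset.card_eq_sum_card_fiberwise (f := Finsupp.support)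
    (t := Finset.univ.filter Δ.IsFace) (fun m hm => by simpa using (Finset.mem_filter.mp hm).2)]
  congr 1
  refine Finset.sum_congr rfl fun F hF => ?_
  rw [Finset.filter_filter]
  congr 1
  refine Finset.filter_congr fun m _ => ?_
  exact and_iff_right_of_imp fun h => h ▸ (Finset.mem_filter.mp hF).2

open Classical in
/-- The coefficients of `(1 - z) ^ n H(z)` are alternating sums of reduced Euler characteristics of
induced subcomplexes. -/
theorem coeff_one_sub_X_pow_mul_hilbertSeries (j : ℕ) :
    PowerSeries.coeff j ((1 - PowerSeries.X) ^ n * Δ.hilbertSeries k) =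
      (-1) ^ j * ∑ W ∈ Finset.powersetCard j (Finset.univ : Finset (Fin n)),
        ∑ F ∈ W.powerset, if Δ.IsFace F then (-1) ^ F.card else 0 := by
  have hg : (1 - PowerSeries.X) * (PowerSeries.mk fun m => if m = 0 then 0 else 1) =
      (PowerSeries.X : PowerSeries ℤ) := by
    ext m
    rw [sub_mul, one_mul, map_sub]
    rcases m with _ | _ | m <;> simp [PowerSeries.coeff_succ_X_mul, PowerSeries.coeff_X]
  have hterm (F : Finset (Fin n)) : (1 - PowerSeries.X) ^ n *
      (PowerSeries.mk fun m => if m = 0 then 0 else 1) ^ F.card =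
      (PowerSeries.X : PowerSeries ℤ) ^ F.card *
        (1 - PowerSeries.X) ^ (Fintype.card (Fin n) - F.card) := by
    nth_rw 2 [← hg]
    rw [mul_pow, mul_right_comm, ← pow_add, Fintype.card_fin,
      Nat.add_sub_cancel' (card_finset_fin_le F)]
  rw [hilbertSeries_eq_sum, Finset.mul_sum, map_sum]
  simp only [hterm, PowerSeries.coeff_X_pow_mul_one_sub_X_pow]
  rw [Finset.sum_comm, Finset.mul_sum]
  refine Finset.sum_congr rfl fun W _ => ?_
  have hW : W.powerset = Finset.univ.filter fun F => F ⊆ W := by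
    ext F
    simp
  rw [Finset.mul_sum, hW, Finset.sum_filter, Finset.sum_filter]
  refine Finset.sum_congr rfl fun F _ => ?_
  split_ifs <;> simp

/-- The dimension of a complex is less than the number of vertices. -/
theorem dimSucc_le : Δ.dimSucc ≤ n := by
  -- This form needs no face to exist: for `n = 0` the supremum is that of the empty set, namely
  -- `0`.
  refine csSup_le' ?_
  rintro _ ⟨F, -, rfl⟩
  exact card_finset_fin_le F

/-- The alternating sums of the `h`-vector are the coefficients of `(1 - z) ^ n H(z)`. -/
theorem sum_hVector_mul_choose (j : ℕ) :
    ∑ l ∈ Finset.range (j + 1),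
      (-1 : ℤ) ^ l * Δ.hVector k (j - l) * ((n - Δ.dimSucc).choose l : ℤ) =
      PowerSeries.coeff j ((1 - PowerSeries.X) ^ n * Δ.hilbertSeries k) := by
  have h : (1 - PowerSeries.X) ^ n * Δ.hilbertSeries k = (1 - PowerSeries.X) ^ (n - Δ.dimSucc) *
      ((1 - PowerSeries.X) ^ Δ.dimSucc * Δ.hilbertSeries k) := by
    rw [← mul_assoc, ← pow_add, Nat.sub_add_cancel Δ.dimSucc_le]
  rw [h, PowerSeries.coeff_mul, Finset.Nat.sum_antidiagonal_eq_sum_range_succ_mk]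
  refine Finset.sum_congr rfl fun l _ => ?_
  rw [PowerSeries.coeff_one_sub_X_pow, hVector]
  ring

end AbstractSimplicialComplex

/-! ### Disconnected vertex sets and the conclusion. -/

/-- A set of vertices inducing a disconnected subgraph bounds the projective dimension of the
Stanley-Reisner ring of the clique complex from below. -/
theorem SimpleGraph.not_hasProjectiveDimensionLT_of_not_connected {k : Type*} [Field k] {n : ℕ}
    (G : SimpleGraph (Fin n)) (W : Finset (Fin n)) (hne : W.Nonempty)
    (hW : ¬ (G.induce (W : Set (Fin n))).Connected) (m : ℕ) (hm : m + 1 < W.card) :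
    ¬ HasProjectiveDimensionLT (ModuleCat.of (MvPolynomial (Fin n) k)
      (G.cliqueComplex.StanleyReisnerRing k)) (m + 1) := by
  classical
  obtain ⟨A, B, hA, hB, hAB, hunion, hadj⟩ :=
    SimpleGraph.exists_partition_of_not_connected_induce (Finset.coe_nonempty.mpr hne) hW
  have hdis : Disjoint A.toFinset B.toFinset := Set.disjoint_toFinset.mpr hAB
  refine G.cliqueComplex.not_hasProjectiveDimensionLT_of_not_joined A.toFinset B.toFinset
    (Set.toFinset_nonempty.mpr hA) (Set.toFinset_nonempty.mpr hB) hdis ?_ m ?_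
  · intro a ha b hb hface
    rw [Set.mem_toFinset] at ha hb
    refine hadj a ha b hb (hface.2 (by simp) (by simp) fun h => ?_)
    exact Set.disjoint_left.mp hAB ha (h ▸ hb)
  · have hWeq : A.toFinset ∪ B.toFinset = W := by
      rw [← Set.toFinset_union, ← Finset.coe_inj, Set.coe_toFinset, hunion]
    rwa [← Finset.card_union_of_disjoint hdis, hWeq]

theorem mainTheorem6 {k : Type*} [Field k] (n : ℕ) (G : SimpleGraph (Fin n)) (hG : G.IsChordal)
    (j : ℕ)
    (hj : j = 1 ∨
      (G.cliqueComplex.stanleyReisnerProjDim k + 2 < (j : WithBot ℕ∞) ∧ j ≤ n)) :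
    ∑ l ∈ Finset.range (j + 1),
      (-1 : ℤ) ^ l * G.cliqueComplex.hVector k (j - l) *
        ((n - G.cliqueComplex.dimSucc).choose l : ℤ) = 0 := by
  classical
  rw [G.cliqueComplex.sum_hVector_mul_choose, G.cliqueComplex.coeff_one_sub_X_pow_mul_hilbertSeries]
  have hface (F : Finset (Fin n)) :
      G.cliqueComplex.IsFace F ↔ G.IsClique (F : Set (Fin n)) := by
    refine ⟨fun h => ?_, fun h hne => ⟨hne, h⟩⟩
    rcases F.eq_empty_or_nonempty with rfl | hne
    · simp
    · exact (h hne).2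
  simp only [hface]
  suffices hconn : ∀ W : Finset (Fin n), W.card = j → (G.induce (W : Set (Fin n))).Connected by
    rw [Finset.sum_eq_zero, mul_zero]
    exact fun W hW => hG.sum_cliques_eq_zero W (hconn W (Finset.mem_powersetCard.mp hW).2)
  intro W hW
  by_contra hdisc
  rcases hj with rfl | ⟨hj, -⟩
  · obtain ⟨v, rfl⟩ := Finset.card_eq_one.mp hW
    refine hdisc ?_
    rw [Finset.coe_singleton]
    exact SimpleGraph.Connected.mk (SimpleGraph.Preconnected.of_subsingleton)
  -- The projective dimension is not `⊥` because `k[Δ]` is nonzero; this gives `j > 2`, so `j - 2`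
  -- below is not truncated.
  have hpd : ((0 : ℕ) : WithBot ℕ∞) ≤ G.cliqueComplex.stanleyReisnerProjDim k :=
    (projectiveDimension_ge_iff _ 0).mpr fun h =>
      not_subsingleton_iff_nontrivial.mpr (G.cliqueComplex.nontrivial_stanleyReisnerRing (k := k))
        (ModuleCat.isZero_of_iff_subsingleton.mp
          ((hasProjectiveDimensionLT_zero_iff_isZero _).mp h))
  have hj2 : 2 < j := by
    have : ((0 : ℕ) : WithBot ℕ∞) + 2 < j := (add_le_add_left hpd 2).trans_lt hj
    exact_mod_cast this
  obtain ⟨m, rfl⟩ : ∃ m, j = m + 2 := ⟨j - 2, by omega⟩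
  refine G.not_hasProjectiveDimensionLT_of_not_connected (k := k) W
    (Finset.card_pos.mp (by omega)) hdisc m (by omega) (projectiveDimension_lt_iff.mp ?_)
  by_contra hle
  have : ((m + 1 : ℕ) : WithBot ℕ∞) + 2 < (m + 2 : ℕ) :=
    (add_le_add_left (not_lt.mp hle) 2).trans_lt hj
  have : m + 1 + 2 < m + 2 := by exact_mod_cast this
  omega
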